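/- Let $n\ge 2$ and $r\ge 1$ be integers. \emph{Stars.} A \emph{strand} is a (possibly empty) sequence of marked and unmarked vertices in which no two marked vertices are consecutive and whose final vertex, if there is one, is unmarked. An \emph{$n$-star} is the identification of $n$ strands, labeled by $[n]=\{1,\dots,n\}$, at their final vertex, that is, an $n$-tuple of strands (for empty strands there is nothing to identify), and $\mathrm{Star}_n(r)$ is the set of all $n$-stars whose strands each have $r-1$ unmarked vertices. A \emph{closing substrand} of a strand $v_1\cdots v_\ell$ is either the entire strand, or a sequence $v_{i+1}\cdots v_\ell$ with $v_i$ marked; in the second case it is called \emph{proper}. For $X\subseteq[n]$, an \emph{$X$-central substar} $c$ of $s\in \mathrm{Star}_n(r)$ is a choice, for each $i\in X$, of a closing substrand of the $i$-th strand of $s$, such that either all of the chosen closing substrands are entire strands, or all of them are proper and have the same number of unmarked vertices. A \emph{central star permutation} of $s$ by $c$ is an $n$-star obtained from $s$ by permuting the chosen closing substrands among the strands labeled by $X$ by some permutation of $X$. Write $s\sim s'$ if there is a finite sequence $s=s_0,s_1,\dots,s_k=s'$ in $\mathrm{Star}_n(r)$ such that $s_i$ is a central star permutation of $s_{i-1}$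 for $i=1,\dots,k$; this is an equivalence relation. \emph{Juggling sequences.} A \emph{state} is a finite vector $\langle s_1,\dots,s_h\rangle$ of nonnegative integers, where trailing zeros are ignored. A \emph{multiplex juggling sequence} for $n$ balls of length $r$ is a tuple $({\bf s}_0,\dots,{\bf s}_r)$ of states, each with entry sum $n$, such that for each $0\le i<r$, if ${\bf s}_i=\langle s_1,\dots,s_h\rangle$, then ${\bf s}_{i+1}=\langle s_2+b_1,\dots,s_h+b_{h-1},b_h,\dots,b_{h'}\rangle$ for some nonnegative integers $b_j$ with $\sum_{j=1}^{h'} b_j=s_1$. Let $\mathrm{js}({\bf a},{\bf b},r)$ be the number of such sequences with ${\bf s}_0={\bf a}$ and ${\bf s}_r={\bf b}$, where $n$ is the entry sum of ${\bf a}$. \textbf{Theorem.} If $n\ge 2$ and $r\ge 1$ are integers, then the set of multiplex juggling sequences of length $r$ with initial and final state $\langle n\rangle$ and the set $\mathrm{Star}_n(r)/{\sim}$ are finite, and $$\mathrm{js}(\langle n\rangle,\langle n\rangle,r)=|\mathrm{Star}_n(r)/{\sim}|.$$ -/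

import Mathlib

namespace StarJuggling

/-! ### Strands and `n`-stars -/

/-- A vertex is marked or unmarked. -/
inductive Vertex : Type
  | marked : Vertex
  | unmarked : Vertex

/-- The Boolean test for unmarked vertices. -/
def Vertex.isUnmarked : Vertex → Bool
  | .marked => false
  | .unmarked => true

/-- The number of unmarked vertices in a sequence of vertices. -/
def numUnmarked (v : List Vertex) : ℕ := v.countP Vertex.isUnmarked

/-- A strand is a sequence of vertices in which no two marked vertices are consecutive and whose
final vertex is unmarked. The empty sequence (the only one without unmarked vertices, needed for
`Star n 1`) is included. -/
structure IsStrand (v : List Vertex) : Prop where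
  nonconsecutive : v.IsChain (fun a b => ¬ (a = .marked ∧ b = .marked))
  final_unmarked : ∀ a ∈ v.getLast?, a = .unmarked

/-- A closing substrand of `v` is the entire `v`, or what remains after deleting an initial segment
that ends in a marked vertex. -/
def IsClosingSubstrand (q v : List Vertex) : Prop :=
  q = v ∨ ∃ p : List Vertex, v = p ++ .marked :: q

/-- `Star n r`: the `n`-stars, with strands labeled by `Fin n`, all of whose strands have `r - 1`
unmarked vertices. -/
def Star (n r : ℕ) : Type :=
  {s : Fin n → List Vertex // ∀ i, IsStrand (s i) ∧ numUnmarked (s i) + 1 = r}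

/-- `c` is an `X`-central substar of `s`: `c i` (for `i ∈ X`) is a closing substrand of the `i`-th
strand, and all these have the same number of unmarked vertices. An entire strand carries an
implicit unmarked vertex in front of it (it encodes all of `1, …, r`, whereas a proper closing
substrand with `k` unmarked vertices encodes the last `k` of these), so an entire strand never
counts as having as many unmarked vertices as a proper closing substrand. -/
structure IsCentralSubstar {n r : ℕ} (s : Star n r) (X : Finset (Fin n))
    (c : Fin n → List Vertex) : Prop where
  closing : ∀ i ∈ X, IsClosingSubstrand (c i) (s.1 i)
  entire_or_proper : (∀ i ∈ X, c i = s.1 i) ∨ (∀ i ∈ X, c i ≠ s.1 i)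
  numUnmarked_eq : ∀ i ∈ X, ∀ j ∈ X, numUnmarked (c i) = numUnmarked (c j)

/-- `s'` arises from `s` by permuting the closing substrands of an `X`-central substar by some
permutation of `X`. -/
def IsCentralStarPermutation {n r : ℕ} (s s' : Star n r) : Prop :=
  ∃ (X : Finset (Fin n)) (c : Fin n → List Vertex) (σ : Equiv.Perm (Fin n)),
    IsCentralSubstar s X c ∧ (∀ i ∉ X, σ i = i) ∧
    (∀ i ∈ X, ∃ p : List Vertex, s.1 i = p ++ c i ∧ s'.1 i = p ++ c (σ i)) ∧
    (∀ i ∉ X, s'.1 i = s.1 i)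

/-- The relation `∼` on stars: a finite sequence of central star permutations. -/
def StarRel {n r : ℕ} : Star n r → Star n r → Prop :=
  Relation.ReflTransGen IsCentralStarPermutation

theorem IsCentralStarPermutation.symm {n r : ℕ} {s s' : Star n r}
    (h : IsCentralStarPermutation s s') : IsCentralStarPermutation s' s := by
  obtain ⟨X, c, σ, hc, hσ, hX, hX'⟩ := h
  have hmem : ∀ i ∈ X, σ i ∈ X := by
    intro i hi
    by_contra hn
    have h1 := σ.injective (hσ _ hn)
    rw [h1] at hn
    exact hn hi
  refine ⟨X, fun i => c (σ i), σ⁻¹, ⟨?_, ?_, ?_⟩, ?_, ?_, ?_⟩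
  · intro i hi
    obtain ⟨p, h1, h2⟩ := hX i hi
    rcases hc.closing i hi with h | ⟨t, ht⟩
    · left
      rw [← h] at h1
      have hp : p = [] := by simpa using h1
      simp [h2, hp]
    · right
      refine ⟨t, ?_⟩
      rw [ht] at h1
      have hp : p = t ++ [.marked] := by
        have h3 : (t ++ [Vertex.marked]) ++ c i = p ++ c i := by simpa using h1
        exact (List.append_cancel_right h3).symm
      simp [h2, hp]
  · rcases hc.entire_or_proper with h | h
    · left
      intro i hi
      obtain ⟨p, h1, h2⟩ := hX i hi
      rw [← h i hi] at h1
      have hp : p = [] := by simpa using h1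
      simp [h2, hp]
    · right
      intro i hi he
      obtain ⟨p, h1, h2⟩ := hX i hi
      rw [h2] at he
      have hp : p = [] := by simpa using he
      exact h i hi (by simp [h1, hp])
  · intro i hi j hj
    exact hc.numUnmarked_eq _ (hmem i hi) _ (hmem j hj)
  · intro i hi
    rw [Equiv.Perm.inv_eq_iff_eq, hσ i hi]
  · intro i hi
    obtain ⟨p, h1, h2⟩ := hX i hi
    exact ⟨p, h2, by simpa using h1⟩
  · intro i hi
    exact (hX' i hi).symm

/-- `∼` is an equivalence relation. -/
instance starSetoid (n r : ℕ) : Setoid (Star n r) where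
  r := StarRel
  iseqv :=
    { refl := fun _ => Relation.ReflTransGen.refl
      symm := fun h => by
        induction h with
        | refl => exact Relation.ReflTransGen.refl
        | tail _ h2 ih => exact Relation.ReflTransGen.head h2.symm ih
      trans := fun h h' => Relation.ReflTransGen.trans h h' }

/-- The set `Star_n(r)/∼`. -/
def StarClass (n r : ℕ) : Type := Quotient (starSetoid n r)

/-! ### Multiplex juggling sequences -/

/-- A state: a vector of nonnegative integers, trailing zeros being ignored. The first entry has
index `0`. -/
abbrev State : Type := ℕ →₀ ℕ

/-- The number of balls of a state: the sum of its entries. -/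
def State.balls (s : State) : ℕ := s.sum fun _ k => k

/-- One time step: all balls fall by one position and the balls of the bottom position are
redistributed according to `b`. -/
def IsStep (s s' : State) : Prop :=
  ∃ b : ℕ →₀ ℕ, s 0 = (b.sum fun _ k => k) ∧ ∀ j, s' j = s (j + 1) + b j

/-- `S = (s₀, …, s_r)` is a multiplex juggling sequence for `n` balls of length `r`. -/
structure IsMultiplexJugglingSeq (n r : ℕ) (S : Fin (r + 1) → State) : Prop where
  balls_eq : ∀ i, (S i).balls = n
  step : ∀ i : Fin r, IsStep (S i.castSucc) (S i.succ)

/-- `JS(a, b, r)`: the multiplex juggling sequences of length `r` with initial state `a` and final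
state `b`; the number of balls is the entry sum of `a`. -/
def JS (a b : State) (r : ℕ) : Set (Fin (r + 1) → State) :=
  {S | IsMultiplexJugglingSeq a.balls r S ∧ S 0 = a ∧ S (Fin.last r) = b}

/-- `js(a, b, r)`: the cardinality of `JS(a, b, r)`. -/
noncomputable def js (a b : State) (r : ℕ) : ℕ := (JS a b r).ncard

/-- The state `⟨n⟩`. -/
noncomputable def bottomState (n : ℕ) : State := Finsupp.single 0 n

end StarJuggling

/-!
A strand with `r - 1` unmarked vertices is the itinerary of one ball: reading its unmarked vertices
as the times `1, …, r - 1`, a mark in front of the `t`-th one says that the ball is in the hand at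
time `t`; every ball is also in the hand at the times `0` and `r`. An `n`-star is thus a juggling
pattern with *labeled* balls, and a central star permutation exchanges the futures of some balls
which are in the hand at the same moment.

Forgetting the labels sends a star to the sequence of histograms of the heights of its balls
(`Star.states`), where the height of a ball is the time until it is next in the hand. This is a
multiplex juggling sequence from `⟨n⟩` to `⟨n⟩`, and the theorem holds because the map induces a
bijection from `Star n r / ∼`.

* It is constant on classes: exchanging the futures of balls in the hand at time `t` changes no
  height up to `t`, and permutes the heights after `t` (`IsCentralStarPermutation.states_eq`).
* It is injective on classes: if two stars have the same histograms and their labeled heights agree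
  up to time `t`, then the balls in the hand at time `t` are the same, and their heights at time
  `t + 1` are the same up to a permutation. Exchanging futures accordingly makes the labeled
  heights agree up to time `t + 1` (`starRel_of_states_eq`).
* It is surjective: the labels of the balls can be carried along through the throws of a juggling
  sequence, one step at a time (`exists_heights_of_isStep`, `exists_states_eq`).
-/

namespace StarJuggling

open Finset

/-! ### Strands as binary words -/

/-- The strand with one unmarked vertex per letter, preceded by a mark when the letter is `true`. -/
def strandOfWord : List Bool → List Vertex
  | [] => []
  | true :: w => .marked :: .unmarked :: strandOfWord w
  | false :: w => .unmarked :: strandOfWord w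

/-- The word of a strand: its letters say which unmarked vertices are preceded by a mark. The last
two cases do not occur in strands. -/
def wordOfStrand : List Vertex → List Bool
  | [] => []
  | .unmarked :: v => false :: wordOfStrand v
  | .marked :: .unmarked :: v => true :: wordOfStrand v
  | .marked :: .marked :: v => true :: wordOfStrand v
  | [.marked] => []

@[simp]
theorem wordOfStrand_strandOfWord (w : List Bool) : wordOfStrand (strandOfWord w) = w := by
  induction w with
  | nil => rfl
  | cons b w ih => cases b <;> simp [strandOfWord, wordOfStrand, ih]

theorem strandOfWord_append (w w' : List Bool) :
    strandOfWord (w ++ w') = strandOfWord w ++ strandOfWord w' := by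
  induction w with
  | nil => rfl
  | cons b w ih => cases b <;> simp [strandOfWord, ih]

@[simp]
theorem numUnmarked_strandOfWord (w : List Bool) : numUnmarked (strandOfWord w) = w.length := by
  induction w with
  | nil => rfl
  | cons b w ih =>
    unfold numUnmarked at ih
    cases b <;> simp [strandOfWord, numUnmarked, List.countP_cons, Vertex.isUnmarked, ih]

theorem IsStrand.of_cons {a : Vertex} {v : List Vertex} (h : IsStrand (a :: v)) : IsStrand v := by
  refine ⟨(List.isChain_cons.1 h.nonconsecutive).2, fun b hb => h.final_unmarked b ?_⟩
  rw [Option.mem_def] at hb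
  simp [List.getLast?_cons, hb]

theorem IsStrand.cons_unmarked {v : List Vertex} (h : IsStrand v) :
    IsStrand (.unmarked :: v) := by
  refine ⟨List.isChain_cons.2 ⟨by simp, h.nonconsecutive⟩, fun b hb => ?_⟩
  rcases hv : v.getLast? with _ | c
  · simpa [List.getLast?_cons, hv] using hb.symm
  · have : c = b := by simpa [List.getLast?_cons, hv] using hb
    exact this ▸ h.final_unmarked c hv

theorem isStrand_strandOfWord (w : List Bool) : IsStrand (strandOfWord w) := by
  induction w with
  | nil => exact ⟨List.isChain_nil, by simp [strandOfWord]⟩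
  | cons b w ih =>
    cases b
    · exact ih.cons_unmarked
    · refine ⟨List.isChain_cons.2 ⟨by simp, ih.cons_unmarked.nonconsecutive⟩, fun b hb => ?_⟩
      refine ih.cons_unmarked.final_unmarked b ?_
      simpa [strandOfWord, List.getLast?_cons] using hb

theorem strandOfWord_wordOfStrand {v : List Vertex} (h : IsStrand v) :
    strandOfWord (wordOfStrand v) = v := by
  induction v using wordOfStrand.induct with
  | case1 => rfl
  | case2 v ih => simp [strandOfWord, wordOfStrand, ih h.of_cons]
  | case3 v ih => simp [strandOfWord, wordOfStrand, ih h.of_cons.of_cons]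
  | case4 v _ => exact absurd h.nonconsecutive (by simp)
  | case5 => exact absurd (h.final_unmarked .marked rfl) (by simp)

theorem exists_of_strandOfWord_eq {w : List Bool} {p q : List Vertex}
    (h : strandOfWord w = p ++ .marked :: q) :
    ∃ p' q', w = p' ++ true :: q' ∧ p = strandOfWord p' ∧ q = .unmarked :: strandOfWord q' := by
  induction w generalizing p with
  | nil => simp [strandOfWord] at h
  | cons b w ih =>
    cases b
    · rcases p with _ | ⟨a, p⟩
      · simp [strandOfWord] at h
      · simp only [strandOfWord, List.cons_append, List.cons.injEq] at h
        obtain ⟨p', q', rfl, rfl, rfl⟩ := ih h.2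
        exact ⟨false :: p', q', rfl, by simp [strandOfWord, ← h.1], rfl⟩
    · rcases p with _ | ⟨a, _ | ⟨a', p⟩⟩
      · simp only [strandOfWord, List.nil_append, List.cons.injEq, true_and] at h
        exact ⟨[], w, rfl, rfl, h.symm⟩
      · simp [strandOfWord] at h
      · simp only [strandOfWord, List.cons_append, List.cons.injEq] at h
        obtain ⟨p', q', rfl, rfl, rfl⟩ := ih h.2.2
        exact ⟨true :: p', q', rfl, by simp [strandOfWord, ← h.1, ← h.2.1], rfl⟩

/-! ### Waiting times -/

/-- The number of letters before the first `true`, or the length if there is none. -/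
def waitingTime : List Bool → ℕ
  | [] => 0
  | true :: _ => 0
  | false :: w => waitingTime w + 1

theorem waitingTime_append_true (p q q' : List Bool) :
    waitingTime (p ++ true :: q) = waitingTime (p ++ true :: q') := by
  induction p with
  | nil => rfl
  | cons b p ih => cases b <;> simp [waitingTime, ih]

theorem waitingTime_drop_append_true {p : List Bool} {k : ℕ} (hk : k ≤ p.length)
    (q q' : List Bool) :
    waitingTime ((p ++ true :: q).drop k) = waitingTime ((p ++ true :: q').drop k) := by
  rw [List.drop_append_of_le_length hk, List.drop_append_of_le_length hk]
  exact waitingTime_append_true _ _ _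

theorem waitingTime_drop_succ {w : List Bool} {k : ℕ} (h : waitingTime (w.drop k) ≠ 0) :
    waitingTime (w.drop (k + 1)) + 1 = waitingTime (w.drop k) := by
  rw [← List.tail_drop]
  rcases hw : w.drop k with _ | ⟨_ | _, w'⟩ <;> simp_all [waitingTime]

theorem waitingTime_drop_eq_zero {w : List Bool} {k : ℕ} (hk : k < w.length) :
    waitingTime (w.drop k) = 0 ↔ w[k] = true := by
  rw [List.drop_eq_getElem_cons hk]
  cases w[k] <;> simp [waitingTime]

theorem eq_of_waitingTime_eq {w w' : List Bool} (hl : w.length = w'.length)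
    (h : ∀ k < w.length, waitingTime (w.drop k) = waitingTime (w'.drop k)) : w = w' := by
  refine List.ext_getElem hl fun k hk hk' => ?_
  rw [Bool.eq_iff_iff, ← waitingTime_drop_eq_zero hk, ← waitingTime_drop_eq_zero hk', h k hk]

/-! ### Itineraries and heights of labeled balls -/

/-- The word whose letter `t`, for `t < r`, says whether the ball labeled `i` is in the hand at time
`t`: the word of the `i`-th strand, preceded by `true` for time `0`. -/
def itinerary {n r : ℕ} (s : Star n r) (i : Fin n) : List Bool := true :: wordOfStrand (s.1 i)

variable {n r : ℕ}

theorem Star.strandOfWord_wordOfStrand (s : Star n r) (i : Fin n) :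
    strandOfWord (wordOfStrand (s.1 i)) = s.1 i :=
  StarJuggling.strandOfWord_wordOfStrand (s.2 i).1

theorem length_itinerary (s : Star n r) (i : Fin n) : (itinerary s i).length = r := by
  have h := (s.2 i).2
  rw [← s.strandOfWord_wordOfStrand i, numUnmarked_strandOfWord] at h
  simpa [itinerary] using h

theorem Star.ext_itinerary {s s' : Star n r} (h : ∀ i, itinerary s i = itinerary s' i) :
    s = s' := by
  refine Subtype.ext (funext fun i => ?_)
  rw [← s.strandOfWord_wordOfStrand i, ← s'.strandOfWord_wordOfStrand i, (List.cons.inj (h i)).2]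

theorem exists_itinerary_eq (u : Fin n → List Bool) (hl : ∀ i, (u i).length = r)
    (h0 : ∀ i, ∃ w, u i = true :: w) : ∃ s : Star n r, ∀ i, itinerary s i = u i := by
  choose w hw using h0
  refine ⟨⟨fun i => strandOfWord (w i), fun i => ⟨isStrand_strandOfWord _, ?_⟩⟩, fun i => ?_⟩
  · simpa [hw i] using hl i
  · simp [itinerary, hw i]

instance : Finite (Star n r) :=
  Finite.of_injective (β := Fin n → List.Vector Bool r)
    (fun s i => ⟨itinerary s i, length_itinerary s i⟩)
    fun _ _ h => Star.ext_itinerary fun i => congrArg Subtype.val (congrFun h i)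

/-- The height at time `t` of the ball labeled `i`: the time until it is next in the hand. -/
def height (s : Star n r) (t : ℕ) (i : Fin n) : ℕ := waitingTime ((itinerary s i).drop t)

@[simp]
theorem height_zero (s : Star n r) (i : Fin n) : height s 0 i = 0 := rfl

theorem height_last (s : Star n r) (i : Fin n) : height s r i = 0 := by
  rw [height, List.drop_eq_nil_of_le (length_itinerary s i).le, waitingTime]

theorem height_succ {s : Star n r} {t : ℕ} {i : Fin n} (h : height s t i ≠ 0) :
    height s (t + 1) i + 1 = height s t i :=
  waitingTime_drop_succ h

theorem Star.ext_height {s s' : Star n r} (h : ∀ t ≤ r, ∀ i, height s t i = height s' t i) :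
    s = s' := by
  refine Star.ext_itinerary fun i => eq_of_waitingTime_eq ?_ fun k hk => ?_
  · rw [length_itinerary, length_itinerary]
  · exact h k (by rw [length_itinerary] at hk; exact hk.le) i

/-! ### States of labeled balls -/

/-- The state in which the ball labeled `i` has height `f i`. -/
noncomputable def stateOfHeights (f : Fin n → ℕ) : State := ∑ i, Finsupp.single (f i) 1

theorem stateOfHeights_apply (f : Fin n → ℕ) (j : ℕ) :
    stateOfHeights f j = #{i | f i = j} := by
  rw [stateOfHeights, Finsupp.finsetSum_apply, Finset.card_filter]
  simp only [Finsupp.single_apply]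

theorem balls_stateOfHeights (f : Fin n → ℕ) : (stateOfHeights f).balls = n := by
  have h : ∀ s : State, s.balls = Finsupp.degree s := fun s => rfl
  simp [h, stateOfHeights, map_sum]

theorem stateOfHeights_zero : stateOfHeights (fun _ : Fin n => 0) = bottomState n := by
  simp [stateOfHeights, bottomState]

theorem balls_bottomState (n : ℕ) : (bottomState n).balls = n := by
  rw [← stateOfHeights_zero, balls_stateOfHeights]

theorem stateOfHeights_comp (f : Fin n → ℕ) (σ : Equiv.Perm (Fin n)) :
    stateOfHeights (fun i => f (σ i)) = stateOfHeights f :=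
  Equiv.sum_comp σ fun i => Finsupp.single (f i) 1

theorem eq_zero_of_stateOfHeights_eq_bottomState {f : Fin n → ℕ}
    (h : stateOfHeights f = bottomState n) (i : Fin n) : f i = 0 := by
  by_contra hi
  have h1 := DFunLike.congr_fun h (f i)
  rw [stateOfHeights_apply, bottomState, Finsupp.single_eq_of_ne hi, Finset.card_eq_zero] at h1
  exact Finset.notMem_empty i (h1 ▸ by simp)

/-- The heights at which the balls in the hand end up serve as the throws of the step. -/
theorem isStep_stateOfHeights {f g : Fin n → ℕ} (h : ∀ i, f i ≠ 0 → g i + 1 = f i) :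
    IsStep (stateOfHeights f) (stateOfHeights g) := by
  refine ⟨∑ i with f i = 0, Finsupp.single (g i) 1, ?_, fun j => ?_⟩
  · have hd : ∀ b : ℕ →₀ ℕ, (b.sum fun _ k => k) = Finsupp.degree b := fun _ => rfl
    rw [stateOfHeights_apply, hd, map_sum]
    simp
  · rw [stateOfHeights_apply, stateOfHeights_apply, Finsupp.finsetSum_apply]
    simp only [Finsupp.single_apply, ← Finset.card_filter, Finset.filter_filter]
    rw [← Finset.card_union_of_disjoint]
    · congr 1
      ext i
      have := h i
      simp only [mem_filter, mem_univ, true_and, mem_union]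
      grind
    · rw [Finset.disjoint_left]
      intro i
      simp only [mem_filter, mem_univ, true_and]
      omega

/-- Labels can be carried along through a step: the balls in the hand are dealt out to the throws,
and all other balls fall. -/
theorem exists_heights_of_isStep {f : Fin n → ℕ} {s' : State} (h : IsStep (stateOfHeights f) s') :
    ∃ g : Fin n → ℕ, stateOfHeights g = s' ∧ ∀ i, f i ≠ 0 → g i + 1 = f i := by
  obtain ⟨b, hb, hs⟩ := h
  rw [stateOfHeights_apply] at hb
  have hcard : Fintype.card {i // f i = 0} = Fintype.card (Σ j : b.support, Fin (b j)) := by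
    rw [Fintype.card_subtype, hb, Fintype.card_sigma]
    simp only [Fintype.card_fin]
    exact (Finset.sum_coe_sort b.support fun j => b j).symm
  let e := Fintype.equivOfCardEq hcard
  refine ⟨fun i => if hi : f i = 0 then ((e ⟨i, hi⟩).1 : ℕ) else f i - 1, ?_, fun i hi => ?_⟩
  · ext j
    have hthrown : #{x : {i // f i = 0} | ((e x).1 : ℕ) = j} = b j := by
      have h1 : #{x : {i // f i = 0} | ((e x).1 : ℕ) = j} =
          #{y : Σ j : b.support, Fin (b j) | (y.1 : ℕ) = j} :=
        Finset.card_equiv e (by simp)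
      rw [h1, Finset.card_filter, Fintype.sum_sigma]
      have h2 : ∀ k : b.support, (∑ _ : Fin (b k), if (k : ℕ) = j then 1 else 0) =
          if (k : ℕ) = j then b k else 0 := fun k => by simp
      rw [Finset.sum_congr rfl fun k _ => h2 k,
        Finset.sum_coe_sort b.support fun k => if k = j then b k else 0]
      simp +contextual [eq_comm]
    rw [hs j, stateOfHeights_apply, stateOfHeights_apply, ← hthrown,
      ← Finset.card_map (Function.Embedding.subtype _), ← Finset.card_union_of_disjoint]
    · congr 1
      ext i
      by_cases hi : f i = 0
      · simp [hi]
      · have h2 : f i - 1 = j ↔ f i = j + 1 := by omega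
        simp [hi, h2]
    · rw [Finset.disjoint_left]
      intro i
      simp only [mem_filter, mem_univ, true_and, mem_map, Function.Embedding.subtype_apply,
        Subtype.exists, exists_and_right, exists_eq_right, not_exists]
      omega
  · simp only [dif_neg hi]
    omega

/-- If two labelings of a state agree outside `X`, they differ by a permutation of `X`. -/
theorem exists_perm_of_stateOfHeights_eq {f g : Fin n → ℕ}
    (h : stateOfHeights f = stateOfHeights g) (X : Finset (Fin n)) (hX : ∀ i ∉ X, f i = g i) :
    ∃ σ : Equiv.Perm (Fin n), (∀ i ∉ X, σ i = i) ∧ ∀ i, f (σ i) = g i := by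
  have hcount : ∀ j, #{i | i ∈ X ∧ f i = j} = #{i | i ∈ X ∧ g i = j} := by
    intro j
    have h1 := DFunLike.congr_fun h j
    rw [stateOfHeights_apply, stateOfHeights_apply,
      ← Finset.card_filter_add_card_filter_not (s := {i | f i = j}) (· ∈ X),
      ← Finset.card_filter_add_card_filter_not (s := {i | g i = j}) (· ∈ X)] at h1
    have h2 : (({i | f i = j} : Finset (Fin n)).filter (· ∉ X)) =
        ({i | g i = j} : Finset (Fin n)).filter (· ∉ X) := by
      ext i
      simp only [mem_filter, mem_univ, true_and]
      refine and_congr_left fun hi => ?_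
      rw [hX i hi]
    rw [h2, Nat.add_right_cancel_iff, Finset.filter_filter, Finset.filter_filter] at h1
    simpa only [and_comm] using h1
  -- The labels outside `X` are attached to the heights, so that no permutation can move them.
  let tag : (Fin n → ℕ) → Fin n → ℕ ⊕ Fin n := fun f i => if i ∈ X then .inl (f i) else .inr i
  have e : ∀ c, Nonempty ({i // tag g i = c} ≃ {i // tag f i = c}) := by
    intro c
    rw [← Fintype.card_eq, Fintype.card_subtype, Fintype.card_subtype]
    rcases c with j | k
    · have h1 : ∀ f : Fin n → ℕ, ∀ i, tag f i = .inl j ↔ i ∈ X ∧ f i = j := by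
        intro f i
        by_cases hi : i ∈ X <;> simp [tag, hi]
      simp only [h1]
      exact (hcount j).symm
    · have h1 : ∀ f : Fin n → ℕ, ∀ i, tag f i = .inr k ↔ i ∉ X ∧ i = k := by
        intro f i
        by_cases hi : i ∈ X <;> simp [tag, hi]
      simp only [h1]
  have hσ : ∀ i, tag f (Equiv.ofFiberEquiv (fun c => (e c).some) i) = tag g i :=
    Equiv.ofFiberEquiv_map _
  generalize Equiv.ofFiberEquiv (fun c => (e c).some) = σ at hσ
  have hfix : ∀ i ∉ X, σ i = i := by
    intro i hi
    have h1 := hσ i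
    by_cases h2 : σ i ∈ X
    · simp [tag, hi, h2] at h1
    · simpa [tag, hi, h2] using h1
  refine ⟨σ, hfix, fun i => ?_⟩
  by_cases hi : i ∈ X
  · have h1 := hσ i
    by_cases h2 : σ i ∈ X
    · simpa [tag, hi, h2] using h1
    · simp [tag, hi, h2] at h1
  · rw [hfix i hi, hX i hi]

theorem apply_of_perm_fixes_not {α : Type*} {P : α → Prop} {σ : Equiv.Perm α}
    (hσ : ∀ a, ¬ P a → σ a = a) {a : α} (ha : P a) : P (σ a) := by
  by_contra hn
  rw [σ.injective (hσ _ hn)] at hn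
  exact hn ha

/-! ### Central star permutations as exchanges of futures -/

/-- A central star permutation exchanges the parts of the itineraries that follow a common moment
at which the balls in `X` are in the hand. The moment is recorded by the common length of the
parts `q i` after it. -/
theorem IsCentralStarPermutation.exists_itinerary_eq {s s' : Star n r}
    (h : IsCentralStarPermutation s s') :
    ∃ (X : Finset (Fin n)) (σ : Equiv.Perm (Fin n)) (p q : Fin n → List Bool),
      (∀ i ∉ X, σ i = i) ∧ (∀ i ∈ X, σ i ∈ X) ∧
      (∀ i ∈ X, ∀ j ∈ X, (q i).length = (q j).length) ∧
      (∀ i ∈ X, itinerary s i = p i ++ true :: q i ∧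
        itinerary s' i = p i ++ true :: q (σ i)) ∧
      (∀ i ∉ X, itinerary s' i = itinerary s i) := by
  obtain ⟨X, c, σ, hc, hσ, hX, hX'⟩ := h
  have hmem : ∀ i ∈ X, σ i ∈ X := fun i hi => apply_of_perm_fixes_not hσ hi
  have hout : ∀ i ∉ X, itinerary s' i = itinerary s i := fun i hi => by
    rw [itinerary, itinerary, hX' i hi]
  rcases hc.entire_or_proper with he | hp
  · refine ⟨X, σ, fun _ => [], fun i => wordOfStrand (s.1 i), hσ, hmem, ?_, ?_, hout⟩
    · intro i _ j _
      have h1 := length_itinerary s i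
      have h2 := length_itinerary s j
      simp only [itinerary, List.length_cons] at h1 h2
      exact Nat.add_right_cancel (h1.trans h2.symm)
    · intro i hi
      obtain ⟨p, h1, h2⟩ := hX i hi
      rw [← he i hi] at h1
      have h3 : p = [] := by simpa using h1
      refine ⟨rfl, ?_⟩
      rw [itinerary, h2, h3, he _ (hmem i hi)]
      rfl
  · have hex : ∀ i, ∃ p q : List Bool, i ∈ X → wordOfStrand (s.1 i) = p ++ true :: q ∧
        s.1 i = (strandOfWord p ++ [.marked]) ++ c i ∧ c i = .unmarked :: strandOfWord q := by
      intro i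
      by_cases hi : i ∈ X
      · obtain ⟨p, h1⟩ := (hc.closing i hi).resolve_left (hp i hi)
        have h2 := h1
        rw [← s.strandOfWord_wordOfStrand i] at h2
        obtain ⟨p', q', h3, rfl, h5⟩ := exists_of_strandOfWord_eq h2
        exact ⟨p', q', fun _ => ⟨h3, by simpa using h1, h5⟩⟩
      · exact ⟨[], [], fun h => absurd h hi⟩
    choose p q hpq using hex
    refine ⟨X, σ, fun i => true :: p i, q, hσ, hmem, ?_, ?_, hout⟩
    · intro i hi j hj
      have h1 := hc.numUnmarked_eq i hi j hj
      have h2 : ∀ w : List Bool, numUnmarked (.unmarked :: strandOfWord w) = w.length + 1 :=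
        fun w => numUnmarked_strandOfWord (false :: w)
      rw [(hpq i hi).2.2, (hpq j hj).2.2, h2, h2] at h1
      omega
    · intro i hi
      obtain ⟨t, h1, h2⟩ := hX i hi
      obtain ⟨h3, h4, -⟩ := hpq i hi
      have h5 : t = strandOfWord (p i) ++ [.marked] := List.append_cancel_right (h1.symm.trans h4)
      refine ⟨by rw [itinerary, h3]; rfl, ?_⟩
      have h6 : s'.1 i = strandOfWord (p i ++ true :: q (σ i)) := by
        rw [h2, h5, (hpq _ (hmem i hi)).2.2, strandOfWord_append]
        simp [strandOfWord]
      rw [itinerary, h6, wordOfStrand_strandOfWord]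
      rfl

/-- Conversely, the futures after time `t` of balls in the hand at time `t` can be exchanged by a
central star permutation. -/
theorem exists_isCentralStarPermutation (s : Star n r) {t : ℕ} (ht : t < r)
    (σ : Equiv.Perm (Fin n)) (hσ : ∀ i, height s t i ≠ 0 → σ i = i) :
    ∃ s' : Star n r, IsCentralStarPermutation s s' ∧
      ∀ i, itinerary s' i = (itinerary s i).take t ++ (itinerary s (σ i)).drop t := by
  have hmem : ∀ i, height s t i = 0 → height s t (σ i) = 0 := fun i hi =>
    apply_of_perm_fixes_not hσ hi
  rcases t with _ | t
  · refine ⟨⟨fun i => s.1 (σ i), fun i => s.2 (σ i)⟩, ⟨univ, s.1, σ, ⟨?_, ?_, ?_⟩, ?_, ?_, ?_⟩, ?_⟩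
    · exact fun i _ => .inl rfl
    · exact .inl fun i _ => rfl
    · intro i _ j _
      have := (s.2 i).2
      have := (s.2 j).2
      omega
    · simp
    · exact fun i _ => ⟨[], rfl, rfl⟩
    · simp
    · simp [itinerary]
  · have hlen : ∀ i, (wordOfStrand (s.1 i)).length + 1 = r := length_itinerary s
    have hsplit : ∀ i, height s (t + 1) i = 0 → wordOfStrand (s.1 i) =
        (wordOfStrand (s.1 i)).take t ++ true :: (wordOfStrand (s.1 i)).drop (t + 1) := by
      intro i hi
      have ht' : t < (wordOfStrand (s.1 i)).length := by have := hlen i; omega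
      have h1 : (wordOfStrand (s.1 i))[t] = true := (waitingTime_drop_eq_zero ht').1 hi
      rw [← h1, ← List.drop_eq_getElem_cons ht', List.take_append_drop]
    have hstrand : ∀ i, height s (t + 1) i = 0 → s.1 i =
        (strandOfWord ((wordOfStrand (s.1 i)).take t) ++ [.marked]) ++
          .unmarked :: strandOfWord ((wordOfStrand (s.1 i)).drop (t + 1)) := by
      intro i hi
      conv_lhs => rw [← s.strandOfWord_wordOfStrand i, hsplit i hi, strandOfWord_append]
      simp [strandOfWord]
    obtain ⟨s', hs'⟩ := StarJuggling.exists_itinerary_eq (r := r)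
      (fun i => (itinerary s i).take (t + 1) ++ (itinerary s (σ i)).drop (t + 1))
      (fun i => by simp [length_itinerary]; omega) (fun i => ⟨_, rfl⟩)
    have hword : ∀ i, wordOfStrand (s'.1 i) =
        (wordOfStrand (s.1 i)).take t ++ (wordOfStrand (s.1 (σ i))).drop t := by
      intro i
      have := hs' i
      simpa [itinerary] using this
    refine ⟨s', ⟨univ.filter fun i => height s (t + 1) i = 0,
      fun i => .unmarked :: strandOfWord ((wordOfStrand (s.1 i)).drop (t + 1)), σ,
      ⟨?_, ?_, ?_⟩, ?_, ?_, ?_⟩, hs'⟩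
    · intro i hi
      rw [mem_filter] at hi
      exact .inr ⟨_, by simpa using hstrand i hi.2⟩
    · refine .inr fun i hi he => ?_
      rw [mem_filter] at hi
      have h1 := he.trans (hstrand i hi.2)
      rw [List.self_eq_append_left] at h1
      simp at h1
    · intro i _ j _
      have h2 : ∀ w : List Bool, numUnmarked (.unmarked :: strandOfWord w) = w.length + 1 :=
        fun w => numUnmarked_strandOfWord (false :: w)
      have := hlen i
      have := hlen j
      rw [h2, h2, List.length_drop, List.length_drop]
      omega
    · intro i hi
      exact hσ i (by simpa using hi)
    · intro i hi
      rw [mem_filter] at hi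
      refine ⟨_, hstrand i hi.2, ?_⟩
      have ht' : t < (wordOfStrand (s.1 (σ i))).length := by have := hlen (σ i); omega
      have h1 : (wordOfStrand (s.1 (σ i)))[t] = true :=
        (waitingTime_drop_eq_zero ht').1 (hmem i hi.2)
      rw [← s'.strandOfWord_wordOfStrand i, hword, List.drop_eq_getElem_cons ht', h1,
        strandOfWord_append]
      simp [strandOfWord]
    · intro i hi
      rw [← s'.strandOfWord_wordOfStrand i, hword, hσ i (by simpa using hi),
        List.take_append_drop, s.strandOfWord_wordOfStrand]

/-! ### The juggling sequence of a star -/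

/-- The state at time `t` of the juggling pattern described by a star, without labels. -/
noncomputable def Star.states (s : Star n r) (t : ℕ) : State := stateOfHeights (height s t)

theorem Star.states_mem_JS (s : Star n r) :
    (fun t : Fin (r + 1) => s.states t) ∈ JS (bottomState n) (bottomState n) r := by
  refine ⟨⟨fun t => ?_, fun t => ?_⟩, ?_, ?_⟩
  · rw [balls_bottomState]
    exact balls_stateOfHeights _
  · exact isStep_stateOfHeights fun i hi => height_succ hi
  · exact stateOfHeights_zero
  · rw [← stateOfHeights_zero, ← funext (height_last s)]
    rfl

theorem IsCentralStarPermutation.states_eq {s s' : Star n r} (h : IsCentralStarPermutation s s')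
    (t : ℕ) : s.states t = s'.states t := by
  obtain ⟨X, σ, p, q, hσ, hmem, hq, hX, hout⟩ := h.exists_itinerary_eq
  have hlen : ∀ i ∈ X, (p i).length + (q i).length + 1 = r := by
    intro i hi
    rw [← length_itinerary s i, (hX i hi).1]
    simp [add_assoc]
  rw [Star.states, Star.states]
  by_cases ht : ∀ i ∈ X, t + (q i).length < r
  -- Up to the moment of exchange, no height changes.
  · congr 1
    funext i
    by_cases hi : i ∈ X
    · rw [height, height, (hX i hi).1, (hX i hi).2]
      have := hlen i hi
      have := ht i hi
      exact waitingTime_drop_append_true (by omega) _ _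
    · rw [height, height, hout i hi]
  -- After it, the heights are permuted by `σ`.
  · push Not at ht
    obtain ⟨j, hj, ht⟩ := ht
    rw [← stateOfHeights_comp (height s t) σ]
    congr 1
    funext i
    by_cases hi : i ∈ X
    · rw [height, height, (hX _ (hmem i hi)).1, (hX i hi).2]
      have h1 := hlen i hi
      have h2 := hlen _ (hmem i hi)
      have h3 := hq i hi j hj
      have h4 := hq _ (hmem i hi) j hj
      have h5 : (p (σ i)).length = (p i).length := by omega
      rw [List.drop_append, List.drop_append, h5,
        List.drop_eq_nil_of_le (as := p (σ i)) (by omega),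
        List.drop_eq_nil_of_le (as := p i) (by omega)]
    · rw [height, height, hσ i hi, hout i hi]

theorem StarRel.states_eq {s s' : Star n r} (h : StarRel s s') (t : ℕ) :
    s.states t = s'.states t := by
  induction h with
  | refl => rfl
  | tail _ h ih => exact ih.trans (h.states_eq t)

/-- Two stars with the same states can be matched time step by time step. -/
theorem starRel_of_states_eq {s s' : Star n r} (h : ∀ t ≤ r, s.states t = s'.states t) :
    StarRel s s' := by
  have key : ∀ t ≤ r, ∃ s₁, StarRel s s₁ ∧ ∀ k ≤ t, ∀ i, height s₁ k i = height s' k i := by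
    intro t
    induction t with
    | zero => exact fun _ => ⟨s, .refl, fun k hk i => by rw [Nat.le_zero.1 hk]; simp⟩
    | succ t ih =>
      intro ht
      obtain ⟨s₁, hs, hh⟩ := ih (by omega)
      have hstate : stateOfHeights (height s₁ (t + 1)) = stateOfHeights (height s' (t + 1)) :=
        (hs.states_eq (t + 1)).symm.trans (h (t + 1) ht)
      obtain ⟨σ, hσ, hperm⟩ := exists_perm_of_stateOfHeights_eq hstate
        (univ.filter fun i => height s₁ t i = 0) (fun i hi => by
          have hi : height s₁ t i ≠ 0 := by simpa using hi
          have h1 := height_succ hi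
          have h2 := hh t le_rfl i
          have h3 := height_succ (h2 ▸ hi)
          omega)
      have hσ' : ∀ i, height s₁ t i ≠ 0 → σ i = i := fun i hi => hσ i (by simpa using hi)
      obtain ⟨s₂, hs₂, hu⟩ := exists_isCentralStarPermutation s₁ (t := t) (by omega) σ hσ'
      refine ⟨s₂, hs.tail hs₂, fun k hk i => ?_⟩
      have htake : ((itinerary s₁ i).take t).length = t := by
        rw [List.length_take, length_itinerary]
        omega
      rcases Nat.lt_or_eq_of_le hk with hk | rfl
      · rw [← hh k (by omega) i]
        by_cases hi : height s₁ t i = 0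
        -- Both `i` and `σ i` are in the hand at time `t`, so that heights before do not change.
        · have hi' : height s₁ t (σ i) = 0 := apply_of_perm_fixes_not hσ' hi
          have hdrop : ∀ j, height s₁ t j = 0 →
              (itinerary s₁ j).drop t = true :: (itinerary s₁ j).drop (t + 1) := by
            intro j hj
            have htj : t < (itinerary s₁ j).length := by rw [length_itinerary]; omega
            rw [List.drop_eq_getElem_cons htj, (waitingTime_drop_eq_zero htj).1 hj]
          have h1 : itinerary s₁ i =
              (itinerary s₁ i).take t ++ true :: (itinerary s₁ i).drop (t + 1) := by
            rw [← hdrop i hi, List.take_append_drop]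
          rw [height, height, hu i, hdrop _ hi']
          conv_rhs => rw [h1]
          exact waitingTime_drop_append_true (by omega) _ _
        · rw [height, height, hu i, hσ' i hi, List.take_append_drop]
      · rw [← hperm i, height, height, hu i, List.drop_append, htake,
          List.drop_eq_nil_of_le (by omega), List.nil_append, List.drop_drop,
          Nat.add_sub_cancel_left]
  obtain ⟨s₁, hs, hh⟩ := key r le_rfl
  rwa [← Star.ext_height hh]

theorem exists_labeled_heights {S : Fin (r + 1) → State}
    (hS : S ∈ JS (bottomState n) (bottomState n) r) :
    ∃ H : ℕ → Fin n → ℕ, (∀ t : Fin (r + 1), stateOfHeights (H t) = S t) ∧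
      ∀ t < r, ∀ i, H t i ≠ 0 → H (t + 1) i + 1 = H t i := by
  have key : ∀ m (hm : m ≤ r), ∃ H : ℕ → Fin n → ℕ,
      (∀ t (ht : t ≤ m), stateOfHeights (H t) = S ⟨t, by omega⟩) ∧
      ∀ t < m, ∀ i, H t i ≠ 0 → H (t + 1) i + 1 = H t i := by
    intro m
    induction m with
    | zero =>
      refine fun _ => ⟨fun _ _ => 0, fun t ht => ?_, by simp⟩
      obtain rfl := Nat.le_zero.1 ht
      rw [stateOfHeights_zero]
      exact hS.2.1.symm
    | succ m ih =>
      intro hm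
      obtain ⟨H, h1, h2⟩ := ih (by omega)
      have hstep := hS.1.step ⟨m, hm⟩
      have h3 := h1 m le_rfl
      obtain ⟨g, hg, hfall⟩ := exists_heights_of_isStep (f := H m) (h3 ▸ hstep)
      refine ⟨Function.update H (m + 1) g, fun t ht => ?_, fun t ht i => ?_⟩
      · rcases Nat.lt_or_eq_of_le ht with ht | rfl
        · rw [Function.update_of_ne (by omega)]
          exact h1 t (by omega)
        · rw [Function.update_self, hg]
          rfl
      · rw [Function.update_of_ne (show t ≠ m + 1 by omega)]
        rcases Nat.lt_or_eq_of_le (Nat.le_of_lt_succ ht) with ht | rfl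
        · rw [Function.update_of_ne (by omega)]
          exact h2 t ht i
        · rw [Function.update_self]
          exact hfall i
  obtain ⟨H, h1, h2⟩ := key r le_rfl
  exact ⟨H, fun t => h1 t (Nat.le_of_lt_succ t.2), h2⟩

theorem exists_states_eq (hr : 1 ≤ r) {S : Fin (r + 1) → State}
    (hS : S ∈ JS (bottomState n) (bottomState n) r) :
    ∃ s : Star n r, ∀ t : Fin (r + 1), s.states t = S t := by
  obtain ⟨H, hH, hfall⟩ := exists_labeled_heights hS
  have hfirst : ∀ i, H 0 i = 0 :=
    eq_zero_of_stateOfHeights_eq_bottomState ((hH 0).trans hS.2.1)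
  have hlast : ∀ i, H r i = 0 :=
    eq_zero_of_stateOfHeights_eq_bottomState ((hH (Fin.last r)).trans hS.2.2)
  obtain ⟨s, hs⟩ := exists_itinerary_eq (r := r)
    (fun i => (List.range r).map fun t => decide (H t i = 0)) (by simp) (fun i => by
      obtain ⟨m, rfl⟩ := Nat.exists_eq_add_of_le' hr
      rw [List.range_succ_eq_map, List.map_cons, hfirst i]
      exact ⟨_, rfl⟩)
  have hheight : ∀ t ≤ r, ∀ i, height s t i = H t i := by
    intro t ht
    induction ht using Nat.decreasingInduction with
    | self => exact fun i => (height_last s i).trans (hlast i).symm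
    | of_succ t ht ih =>
      intro i
      have htl : t < (itinerary s i).length := by rwa [length_itinerary]
      have h1 : height s t i = 0 ↔ H t i = 0 := by
        rw [height, waitingTime_drop_eq_zero htl]
        simp [hs i]
      by_cases h0 : H t i = 0
      · rw [h0, h1.2 h0]
      · rw [← hfall t ht i h0, ← height_succ (mt h1.1 h0), ih i]
  refine ⟨s, fun t => ?_⟩
  rw [Star.states, funext (hheight t (Nat.le_of_lt_succ t.2)), hH t]

/-- The juggling sequence of a class of stars. -/
noncomputable def StarClass.toJS : StarClass n r → JS (bottomState n) (bottomState n) r :=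
  Quotient.lift (fun s : Star n r => ⟨fun t => s.states t, s.states_mem_JS⟩) fun _ _ h =>
    Subtype.ext (funext fun t => StarRel.states_eq h t)

theorem StarClass.bijective_toJS (hr : 1 ≤ r) :
    Function.Bijective (StarClass.toJS : StarClass n r → _) := by
  refine ⟨fun x y => ?_, fun S => ?_⟩
  · refine Quotient.inductionOn₂ x y fun s s' h => Quotient.sound ?_
    have h := congrArg Subtype.val h
    exact starRel_of_states_eq fun t ht => congrFun h ⟨t, Nat.lt_succ_of_le ht⟩
  · obtain ⟨s, hs⟩ := exists_states_eq hr S.2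
    exact ⟨Quotient.mk _ s, Subtype.ext (funext hs)⟩

instance : Finite (StarClass n r) := inferInstanceAs (Finite (Quotient _))

end StarJuggling

theorem mainTheorem4 (n r : ℕ) (hn : 2 ≤ n) (hr : 1 ≤ r) :
    (StarJuggling.JS (StarJuggling.bottomState n) (StarJuggling.bottomState n) r).Finite ∧
      Finite (StarJuggling.StarClass n r) ∧
      StarJuggling.js (StarJuggling.bottomState n) (StarJuggling.bottomState n) r =
        Nat.card (StarJuggling.StarClass n r) := by
  let e := Equiv.ofBijective _ (StarJuggling.StarClass.bijective_toJS (n := n) hr)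
  refine ⟨Set.finite_coe_iff.1 (Finite.of_equiv _ e), inferInstance, ?_⟩
  rw [StarJuggling.js, ← Nat.card_coe_set_eq]
  exact (Nat.card_congr e).symm
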